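/- Let $q=2^r$ with $r\ge 1$, let $\mathrm{tr}:\mathbb F_q\to\mathbb F_2$, $\mathrm{tr}(x)=x+x^2+\cdots+x^{2^{r-1}}$, be the trace function, and write $\mathrm{Tr}\,A$ for the trace of a square matrix $A$. For $n\ge 1$ let $O^+(2n,q)$ be the group of isometries of $\mathbb F_q^{2n}$ with the quadratic form $\theta^+(x)=\sum_{i=1}^n x_ix_{n+i}$, and let $$P^+(2n,q)=\left\{\begin{bmatrix}A&0\\0&{}^tA^{-1}\end{bmatrix}\begin{bmatrix}1_n&B\\0&1_n\end{bmatrix}\;\middle|\;A\in GL(n,q),\ B\text{ an alternating }n\times n\text{ matrix}\right\}$$ be its maximal parabolic subgroup. For $0\le s\le n$ let $$\sigma_s^+=\begin{bmatrix}0&0&1_s&0\\0&1_{n-s}&0&0\\1_s&0&0&0\\0&0&0&1_{n-s}\end{bmatrix}\in O^+(2n,q).$$ For $i\in\{1,2\}$ with $i\le n$ put $DC_i^{\pm}(n,q)=P^+(2n,q)\,\sigma_{n-i}^+\,P^+(2n,q)$, with the sign $+$ if $n$ is even and $-$ if $n$ is odd. Let $g_1,\dots,g_N$ be any fixed ordering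 of the elements of $DC_i^{\pm}(n,q)$, and define the binary linear code $$C(DC_i^{\pm}(n,q))=\Big\{u\in\mathbb F_2^N\;\Big|\;\sum_{j=1}^N u_j\,\mathrm{Tr}\,g_j=0\text{ in }\mathbb F_q\Big\},$$ with dual $C(DC_i^{\pm}(n,q))^{\perp}\subseteq\mathbb F_2^N$ with respect to the usual inner product. For $a\in\mathbb F_q$ put $$c_i^{\pm}(a)=(\mathrm{tr}(a\,\mathrm{Tr}\,g_1),\dots,\mathrm{tr}(a\,\mathrm{Tr}\,g_N))\in\mathbb F_2^N .$$ Then: (a) The map $\mathbb F_q\to C(DC_1^+(n,q))^\perp$, $a\mapsto c_1^+(a)$, is an $\mathbb F_2$-linear isomorphism for $n\ge 2$ even and all $q$. (b) The map $\mathbb F_q\to C(DC_2^+(n,q))^\perp$, $a\mapsto c_2^+(a)$, is an $\mathbb F_2$-linear isomorphism for $n\ge 4$ even and all $q$, or $n=2$ and $q\ge 4$. (c) The map $\mathbb F_q\to C(DC_1^-(n,q))^\perp$, $a\mapsto c_1^-(a)$, is an $\mathbb F_2$-linear isomorphism for $n\ge 3$ odd and all $q$, or $n=1$ and $q\ge 8$.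 (d) The map $\mathbb F_q\to C(DC_2^-(n,q))^\perp$, $a\mapsto c_2^-(a)$, is an $\mathbb F_2$-linear isomorphism for $n\ge 3$ odd and all $q$. -/

import Mathlib

open scoped Matrix

namespace OrthogonalCode

/-- A square matrix `B` is alternating: zero diagonal and `B i j = - B j i`. -/
def IsAlternating {n : ℕ} {F : Type*} [Field F] (B : Matrix (Fin n) (Fin n) F) : Prop :=
  (∀ i, B i i = 0) ∧ ∀ i j, B i j = - B j i

/-- The quadratic form `θ⁺(x) = ∑ i, x_i x_{n+i}` on `F^{2n}`. The coordinates `1, …, n` are indexed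
by `Sum.inl`, the coordinates `n + 1, …, 2n` by `Sum.inr`. -/
def thetaPlus (n : ℕ) (F : Type*) [Field F] : QuadraticForm F (Fin n ⊕ Fin n → F) :=
  ∑ i : Fin n, QuadraticMap.linMulLin
    (LinearMap.proj (Sum.inl i) : (Fin n ⊕ Fin n → F) →ₗ[F] F)
    (LinearMap.proj (Sum.inr i) : (Fin n ⊕ Fin n → F) →ₗ[F] F)

theorem thetaPlus_apply {n : ℕ} {F : Type*} [Field F] (x : Fin n ⊕ Fin n → F) :
    thetaPlus n F x = ∑ i : Fin n, x (Sum.inl i) * x (Sum.inr i) := by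
  simp [thetaPlus]

/-- The orthogonal group `O⁺(2n, F)`: all isometries of `(F^{2n}, θ⁺)`. -/
def OPlus (n : ℕ) (F : Type*) [Field F] : Subgroup (GL (Fin n ⊕ Fin n) F) where
  carrier := {g | ∀ x, thetaPlus n F ((g : Matrix (Fin n ⊕ Fin n) (Fin n ⊕ Fin n) F) *ᵥ x)
    = thetaPlus n F x}
  mul_mem' := by
    intro a b ha hb x
    rw [Units.val_mul, ← Matrix.mulVec_mulVec, ha, hb]
  one_mem' := by
    intro x
    simp
  inv_mem' := by
    intro a ha x
    rw [← ha, Matrix.mulVec_mulVec, ← Units.val_mul, mul_inv_cancel, Units.val_one,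
      Matrix.one_mulVec]

/-- The matrix of an element of `O⁺(2n, F)`. -/
def toMatrix {n : ℕ} {F : Type*} [Field F] (g : OPlus n F) :
    Matrix (Fin n ⊕ Fin n) (Fin n ⊕ Fin n) F :=
  ((g : GL (Fin n ⊕ Fin n) F) : Matrix (Fin n ⊕ Fin n) (Fin n ⊕ Fin n) F)

theorem toMatrix_injective {n : ℕ} {F : Type*} [Field F] :
    Function.Injective (toMatrix : OPlus n F → _) :=
  fun _ _ h => Subtype.ext (Units.ext h)

/-- The matrix `[A 0; 0 ᵗA⁻¹] [1 B; 0 1]`. -/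
def parabolicMatrix {n : ℕ} {F : Type*} [Field F] (A : GL (Fin n) F)
    (B : Matrix (Fin n) (Fin n) F) : Matrix (Fin n ⊕ Fin n) (Fin n ⊕ Fin n) F :=
  Matrix.fromBlocks (A : Matrix (Fin n) (Fin n) F) 0 0 ((A⁻¹ : GL (Fin n) F) : Matrix _ _ F)ᵀ *
    Matrix.fromBlocks 1 B 0 1

theorem parabolicMatrix_eq {n : ℕ} {F : Type*} [Field F] (A : GL (Fin n) F)
    (B : Matrix (Fin n) (Fin n) F) :
    parabolicMatrix A B = Matrix.fromBlocks (A : Matrix (Fin n) (Fin n) F)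
      ((A : Matrix (Fin n) (Fin n) F) * B) 0
      ((A⁻¹ : GL (Fin n) F) : Matrix _ _ F)ᵀ := by
  simp [parabolicMatrix, Matrix.fromBlocks_multiply]

/-- An alternating matrix has `x ⬝ B x = 0`. -/
theorem IsAlternating.dotProduct_eq_zero {n : ℕ} {F : Type*} [Field F]
    {B : Matrix (Fin n) (Fin n) F} (hB : IsAlternating B) (x : Fin n → F) :
    x ⬝ᵥ (B *ᵥ x) = 0 := by
  simp only [dotProduct, Matrix.mulVec, Finset.mul_sum]
  rw [← Finset.sum_product']
  refine Finset.sum_involution (fun p _ => (p.2, p.1)) ?_ ?_ ?_ ?_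
  · intro p _
    have := hB.2 p.1 p.2
    simp only [this]
    ring
  · intro p _ hp h
    apply hp
    have h1 : p.2 = p.1 := congrArg Prod.fst h
    rw [h1, hB.1]
    ring
  · intro p _
    simp
  · intro p _
    rfl

theorem IsAlternating.add {n : ℕ} {F : Type*} [Field F]
    {B C : Matrix (Fin n) (Fin n) F} (hB : IsAlternating B) (hC : IsAlternating C) :
    IsAlternating (B + C) := by
  refine ⟨fun i => by simp [hB.1 i, hC.1 i], fun i j => ?_⟩
  rw [Matrix.add_apply, Matrix.add_apply, hB.2 i j, hC.2 i j]
  ring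

theorem IsAlternating.neg {n : ℕ} {F : Type*} [Field F]
    {B : Matrix (Fin n) (Fin n) F} (hB : IsAlternating B) : IsAlternating (-B) := by
  refine ⟨fun i => by simp [hB.1 i], fun i j => ?_⟩
  rw [Matrix.neg_apply, Matrix.neg_apply, hB.2 i j]

theorem IsAlternating.congr {n : ℕ} {F : Type*} [Field F]
    {B : Matrix (Fin n) (Fin n) F} (hB : IsAlternating B) (C : Matrix (Fin n) (Fin n) F) :
    IsAlternating (C * B * Cᵀ) := by
  constructor
  · intro i
    have h := hB.dotProduct_eq_zero (C i)
    rw [Matrix.dotProduct_mulVec] at h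
    rw [Matrix.mul_apply]
    exact h
  · have hT : Bᵀ = -B := by
      ext i j
      exact hB.2 j i
    have h : (C * B * Cᵀ)ᵀ = -(C * B * Cᵀ) := by
      simp [Matrix.transpose_mul, hT, Matrix.mul_assoc]
    intro i j
    have := congrFun (congrFun h j) i
    simpa using this

theorem coe_mul_coe_inv {n : ℕ} {F : Type*} [Field F] (A : GL (Fin n) F) :
    (A : Matrix (Fin n) (Fin n) F) * ((A⁻¹ : GL (Fin n) F) : Matrix _ _ F) = 1 := by
  rw [← Units.val_mul, mul_inv_cancel, Units.val_one]

theorem coe_inv_mul_coe {n : ℕ} {F : Type*} [Field F] (A : GL (Fin n) F) :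
    ((A⁻¹ : GL (Fin n) F) : Matrix _ _ F) * (A : Matrix (Fin n) (Fin n) F) = 1 := by
  rw [← Units.val_mul, inv_mul_cancel, Units.val_one]

theorem parabolicMatrix_mul {n : ℕ} {F : Type*} [Field F] (A A' : GL (Fin n) F)
    (B B' : Matrix (Fin n) (Fin n) F) :
    parabolicMatrix A B * parabolicMatrix A' B' = parabolicMatrix (A * A')
      (((A'⁻¹ : GL (Fin n) F) : Matrix _ _ F) * B * ((A'⁻¹ : GL (Fin n) F) : Matrix _ _ F)ᵀ
        + B') := by
  rw [parabolicMatrix_eq, parabolicMatrix_eq, parabolicMatrix_eq, Matrix.fromBlocks_multiply]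
  congr 1
  · simp
  · rw [Units.val_mul, Matrix.mul_add, add_comm]
    congr 1
    · rw [Matrix.mul_assoc (A : Matrix (Fin n) (Fin n) F) (A' : Matrix (Fin n) (Fin n) F),
        ← Matrix.mul_assoc (A' : Matrix (Fin n) (Fin n) F),
        ← Matrix.mul_assoc (A' : Matrix (Fin n) (Fin n) F), coe_mul_coe_inv, Matrix.one_mul,
        Matrix.mul_assoc]
    · rw [Matrix.mul_assoc]
  · simp
  · rw [mul_inv_rev, Units.val_mul, Matrix.transpose_mul]
    simp

theorem parabolicMatrix_one_zero {n : ℕ} {F : Type*} [Field F] :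
    parabolicMatrix (1 : GL (Fin n) F) 0 = 1 := by
  simp [parabolicMatrix]

/-- The element `[A 0; 0 ᵗA⁻¹] [1 B; 0 1]` of `O⁺(2n, F)`, for `A` invertible, `B` alternating. -/
def parabolicElement {n : ℕ} {F : Type*} [Field F] (A : GL (Fin n) F)
    (B : Matrix (Fin n) (Fin n) F) (hB : IsAlternating B) : OPlus n F :=
  ⟨{ val := parabolicMatrix A B
     inv := parabolicMatrix A⁻¹ (-((A : Matrix (Fin n) (Fin n) F) * B *
       (A : Matrix (Fin n) (Fin n) F)ᵀ))
     val_inv := by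
       rw [parabolicMatrix_mul, inv_inv, add_neg_cancel, mul_inv_cancel, parabolicMatrix_one_zero]
     inv_val := by
       rw [parabolicMatrix_mul, inv_mul_cancel]
       have h : ((A⁻¹ : GL (Fin n) F) : Matrix _ _ F) * (-((A : Matrix (Fin n) (Fin n) F) * B *
         (A : Matrix (Fin n) (Fin n) F)ᵀ)) * ((A⁻¹ : GL (Fin n) F) : Matrix _ _ F)ᵀ = -B := by
         rw [Matrix.mul_neg, Matrix.neg_mul, Matrix.mul_assoc, Matrix.mul_assoc,
           ← Matrix.transpose_mul, coe_inv_mul_coe, Matrix.transpose_one, Matrix.mul_one,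
           ← Matrix.mul_assoc, coe_inv_mul_coe, Matrix.one_mul]
       rw [h, neg_add_cancel, parabolicMatrix_one_zero] }, by
    intro x
    obtain ⟨y, z, rfl⟩ : ∃ y z, x = Sum.elim y z := ⟨x ∘ Sum.inl, x ∘ Sum.inr, by simp⟩
    have key : ∀ u v : Fin n → F, thetaPlus n F (Sum.elim u v) = v ⬝ᵥ u := by
      intro u v
      rw [thetaPlus_apply, dotProduct]
      exact Finset.sum_congr rfl fun i _ => by simp [mul_comm]
    change thetaPlus n F (parabolicMatrix A B *ᵥ _) = _
    rw [parabolicMatrix_eq, Matrix.fromBlocks_mulVec]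
    simp only [Sum.elim_comp_inl, Sum.elim_comp_inr, Matrix.zero_mulVec, zero_add, key]
    rw [← Matrix.mulVec_mulVec, ← Matrix.mulVec_add, Matrix.mulVec_transpose,
      Matrix.dotProduct_mulVec, Matrix.vecMul_vecMul, coe_inv_mul_coe, Matrix.vecMul_one,
      dotProduct_add, hB.dotProduct_eq_zero, add_zero]⟩

/-- The maximal parabolic subgroup `P⁺(2n, F)` of `O⁺(2n, F)`, consisting of all
`[A 0; 0 ᵗA⁻¹] [1 B; 0 1]` with `A` invertible and `B` alternating. -/
def PPlus (n : ℕ) (F : Type*) [Field F] : Subgroup (OPlus n F) where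
  carrier := {w | ∃ (A : GL (Fin n) F) (B : Matrix (Fin n) (Fin n) F) (hB : IsAlternating B),
    w = parabolicElement A B hB}
  mul_mem' := by
    rintro _ _ ⟨A, B, hB, rfl⟩ ⟨A', B', hB', rfl⟩
    exact ⟨A * A', _, (hB.congr _).add hB', toMatrix_injective (parabolicMatrix_mul A A' B B')⟩
  one_mem' := ⟨1, 0, ⟨by simp, by simp⟩, toMatrix_injective parabolicMatrix_one_zero.symm⟩
  inv_mem' := by
    rintro _ ⟨A, B, hB, rfl⟩
    exact ⟨A⁻¹, _, (hB.congr _).neg, toMatrix_injective rfl⟩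

/-- The matrix `σ_r⁺ = [0 0 1_r 0; 0 1_{n-r} 0 0; 1_r 0 0 0; 0 0 0 1_{n-r}]`, for `r ≤ n`, in four
blocks of size `n`, two of which are `diag(0, 1_{n-r})` and two of which are `diag(1_r, 0)`. -/
def sigmaMatrix (n r : ℕ) (F : Type*) [Field F] : Matrix (Fin n ⊕ Fin n) (Fin n ⊕ Fin n) F :=
  Matrix.fromBlocks
    (Matrix.diagonal fun i : Fin n => if i.val < r then 0 else 1)
    (Matrix.diagonal fun i : Fin n => if i.val < r then 1 else 0)
    (Matrix.diagonal fun i : Fin n => if i.val < r then 1 else 0)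
    (Matrix.diagonal fun i : Fin n => if i.val < r then 0 else 1)

theorem sigmaMatrix_mul_self (n r : ℕ) (F : Type*) [Field F] :
    sigmaMatrix n r F * sigmaMatrix n r F = 1 := by
  rw [sigmaMatrix, Matrix.fromBlocks_multiply, ← Matrix.fromBlocks_one]
  simp only [Matrix.diagonal_mul_diagonal, Matrix.diagonal_add]
  congr 1
  · rw [← Matrix.diagonal_one]
    congr 1
    funext i
    split_ifs <;> simp
  · rw [← Matrix.diagonal_zero]
    congr 1
    funext i
    split_ifs <;> simp
  · rw [← Matrix.diagonal_zero]
    congr 1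
    funext i
    split_ifs <;> simp
  · rw [← Matrix.diagonal_one]
    congr 1
    funext i
    split_ifs <;> simp

/-- `σ_r⁺` as an element of `O⁺(2n, F)`. -/
def sigmaPlus (n r : ℕ) (F : Type*) [Field F] : OPlus n F :=
  ⟨{ val := sigmaMatrix n r F
     inv := sigmaMatrix n r F
     val_inv := sigmaMatrix_mul_self n r F
     inv_val := sigmaMatrix_mul_self n r F }, by
    intro x
    change thetaPlus n F (sigmaMatrix n r F *ᵥ x) = _
    rw [sigmaMatrix, Matrix.fromBlocks_mulVec, thetaPlus_apply, thetaPlus_apply]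
    refine Finset.sum_congr rfl fun i _ => ?_
    simp only [Sum.elim_inl, Sum.elim_inr, Pi.add_apply, Matrix.mulVec_diagonal,
      Function.comp_apply]
    split_ifs <;> ring⟩

/-- The double coset `P⁺(2n, F) σ_{n-i}⁺ P⁺(2n, F)` in `O⁺(2n, F)`, used for `1 ≤ i ≤ 2`, `i ≤ n`.
It is written `DC_i⁺(n, q)` when `n` is even and `DC_i⁻(n, q)` when `n` is odd. -/
def DC (i n : ℕ) (F : Type*) [Field F] : Set (OPlus n F) :=
  DoubleCoset.doubleCoset (sigmaPlus n (n - i) F) (PPlus n F : Set (OPlus n F))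
    (PPlus n F : Set (OPlus n F))

/-- The matrix trace of an element of `O⁺(2n, F)`. -/
def Tr {n : ℕ} {F : Type*} [Field F] (g : OPlus n F) : F :=
  Matrix.trace (toMatrix g)

/-- The binary linear code `{u ∈ 𝔽₂^N | u · v = 0}` of a vector `v ∈ F^N`, where the dot product is
taken in `F^N`. -/
def binaryCode {F : Type*} [Field F] [Algebra (ZMod 2) F] {N : ℕ} (v : Fin N → F) :
    Submodule (ZMod 2) (Fin N → ZMod 2) where
  carrier := {u | (fun j => algebraMap (ZMod 2) F (u j)) ⬝ᵥ v = 0}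
  zero_mem' := by simp [dotProduct]
  add_mem' := by
    intro a b ha hb
    simp only [Set.mem_ofPred_eq, dotProduct, Pi.add_apply, map_add, add_mul,
      Finset.sum_add_distrib] at *
    rw [ha, hb, add_zero]
  smul_mem' := by
    intro c a ha
    simp only [Set.mem_ofPred_eq, dotProduct, Pi.smul_apply, smul_eq_mul, map_mul, mul_assoc,
      ← Finset.mul_sum] at *
    rw [ha, mul_zero]

/-- The dual of a binary linear code with respect to the usual inner product. -/
def dualCode {N : ℕ} (C : Submodule (ZMod 2) (Fin N → ZMod 2)) :
    Submodule (ZMod 2) (Fin N → ZMod 2) where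
  carrier := {w | ∀ u ∈ C, u ⬝ᵥ w = 0}
  zero_mem' := by simp
  add_mem' := by
    intro a b ha hb u hu
    rw [dotProduct_add, ha u hu, hb u hu, add_zero]
  smul_mem' := by
    intro c a ha u hu
    rw [dotProduct_smul, ha u hu, smul_zero]

/-- For an ordering `g = (g_1, …, g_N)` of a set `S ⊆ O⁺(2n, F)`, the vector
`(Tr g_1, …, Tr g_N) ∈ F^N`. -/
def traceVector {n : ℕ} {F : Type*} [Field F] {S : Set (OPlus n F)} {N : ℕ} (g : Fin N ≃ S) :
    Fin N → F :=
  fun j => Tr (g j : OPlus n F)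

/-- The word `c(a) = (tr(a Tr g_1), …, tr(a Tr g_N)) ∈ 𝔽₂^N`, where `tr` is the trace of `F`
over `𝔽₂`. -/
noncomputable def codeword {n : ℕ} {F : Type*} [Field F] [Algebra (ZMod 2) F]
    {S : Set (OPlus n F)} {N : ℕ} (g : Fin N ≃ S) (a : F) : Fin N → ZMod 2 :=
  fun j => Algebra.trace (ZMod 2) F (a * Tr (g j : OPlus n F))

/-- For every ordering `g` of `S`, the map `a ↦ c(a)` is an `𝔽₂`-linear isomorphism of `F` onto the
dual of the binary code of `(Tr g_1, …, Tr g_N)`. -/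
def CodewordMapIsIso {n : ℕ} {F : Type*} [Field F] [Algebra (ZMod 2) F]
    (S : Set (OPlus n F)) : Prop :=
  ∀ (N : ℕ) (g : Fin N ≃ S),
    ∃ e : F ≃ₗ[ZMod 2] dualCode (binaryCode (traceVector g)),
      ∀ a : F, (e a : Fin N → ZMod 2) = codeword g a

end OrthogonalCode

/-! By Delsarte's theorem the dual of the binary code is exactly the set of words `codeword g a`.
Only injectivity of `a ↦ c(a)` remains: each `a ≠ 0` needs an element `g` of the double coset with
`tr (a * Tr g) ≠ 0`. The trace form is nondegenerate, so it suffices that the matrix traces fill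
`F`, or merely generate it additively.

It is enough to look at products `σ * p` with `p` parabolic. If `i < n` and `2 ≤ n`, a transvection
and a rank-two alternating matrix realize every trace. Two cases are left, both with `σ = 1`. For `i
= n = 2` every trace occurs once `F` has an element other than 0 and 1. For `i = n = 1` the traces
are the `x + x⁻¹`, which generate a subfield; it is all of `F` when `|F| ≥ 8`. -/

namespace OrthogonalCode

/-! ### Delsarte duality and reduction to matrix traces -/

section Delsarte

variable {F : Type*} [Field F] [Algebra (ZMod 2) F]

theorem exists_trace_mul_ne_zero [Finite F] {x : F} (hx : x ≠ 0) :
    ∃ a : F, Algebra.trace (ZMod 2) F (a * x) ≠ 0 := by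
  by_contra! h
  exact hx ((traceForm_nondegenerate (ZMod 2) F).1 x fun a => by
    rw [Algebra.traceForm_apply, mul_comm]; exact h a)

/-- The map `a ↦ c(a)` as a linear map. -/
noncomputable def codewordLinearMap {n : ℕ} {S : Set (OPlus n F)} {N : ℕ} (g : Fin N ≃ S) :
    F →ₗ[ZMod 2] (Fin N → ZMod 2) where
  toFun := codeword g
  map_add' a b := by
    funext j
    simp [codeword, add_mul]
  map_smul' c a := by
    funext j
    simp [codeword]

theorem dotProduct_codeword {n : ℕ} {S : Set (OPlus n F)} {N : ℕ} (g : Fin N ≃ S)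
    (u : Fin N → ZMod 2) (a : F) :
    u ⬝ᵥ codeword g a = Algebra.trace (ZMod 2) F
      (a * ((fun j => algebraMap (ZMod 2) F (u j)) ⬝ᵥ traceVector g)) := by
  simp only [dotProduct, Finset.mul_sum, map_sum, codeword, traceVector]
  refine Finset.sum_congr rfl fun j _ => ?_
  rw [mul_left_comm, ← Algebra.smul_def, map_smul, smul_eq_mul]

theorem mem_binaryCode {N : ℕ} {v : Fin N → F} {u : Fin N → ZMod 2} :
    u ∈ binaryCode v ↔ (fun j => algebraMap (ZMod 2) F (u j)) ⬝ᵥ v = 0 := Iff.rfl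

/-- Delsarte's theorem: the dual of the subfield subcode is the trace code. -/
theorem range_codewordLinearMap [Finite F] {n : ℕ} {S : Set (OPlus n F)} {N : ℕ} (g : Fin N ≃ S) :
    LinearMap.range (codewordLinearMap g) = dualCode (binaryCode (traceVector g)) := by
  apply le_antisymm
  · rintro _ ⟨a, rfl⟩ u hu
    change u ⬝ᵥ codeword g a = 0
    rw [dotProduct_codeword, mem_binaryCode.1 hu, mul_zero, map_zero]
  · intro w hw
    let Φ : (Fin N → ZMod 2) →ₗ[ZMod 2] Module.Dual (ZMod 2) (Fin N → ZMod 2) :=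
      dotProductBilin (ZMod 2) (ZMod 2)
    have hmem : Φ w ∈ Submodule.span (ZMod 2)
        (Set.range fun a : F => Φ (codewordLinearMap g a)) := by
      -- Double annihilator: a functional vanishing on the common kernel of a family lies in its
      -- span. A `u` orthogonal to all codewords is in the code, by nondegeneracy of the trace form.
      refine mem_span_of_iInf_ker_le_ker fun u hu => ?_
      have hu' : ∀ a, u ⬝ᵥ codeword g a = 0 := fun a => by
        rw [dotProduct_comm]
        exact (Submodule.mem_iInf _).1 hu a
      change w ⬝ᵥ u = 0
      rw [dotProduct_comm]
      refine hw u ?_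
      rw [mem_binaryCode]
      by_contra hne
      obtain ⟨a, ha⟩ := exists_trace_mul_ne_zero hne
      exact ha (by rw [← dotProduct_codeword, hu'])
    have hrange : (Set.range fun a : F => Φ (codewordLinearMap g a)) =
        LinearMap.range (Φ ∘ₗ codewordLinearMap g) := by
      ext; simp
    rw [hrange, Submodule.span_eq] at hmem
    obtain ⟨a, ha⟩ := hmem
    refine ⟨a, ?_⟩
    funext j
    simpa [Φ] using LinearMap.congr_fun ha (Pi.single j 1)

theorem codewordMapIsIso_of_exists_trace_ne_zero [Finite F] {n : ℕ} {S : Set (OPlus n F)}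
    (h : ∀ a : F, a ≠ 0 → ∃ g ∈ S, Algebra.trace (ZMod 2) F (a * Tr g) ≠ 0) :
    CodewordMapIsIso S := by
  intro N g
  have hinj : Function.Injective (codewordLinearMap g) := by
    rw [injective_iff_map_eq_zero]
    intro a ha
    by_contra hne
    obtain ⟨s, hs, hne'⟩ := h a hne
    obtain ⟨j, hj⟩ := g.surjective ⟨s, hs⟩
    refine hne' ?_
    have : codeword g a j = 0 := congrFun ha j
    rwa [codeword, hj] at this
  exact ⟨(LinearEquiv.ofInjective _ hinj).trans
    (LinearEquiv.ofEq _ _ (range_codewordLinearMap g)), fun _ => rfl⟩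

theorem codewordMapIsIso_of_Tr_surjective [Finite F] {n : ℕ} {S : Set (OPlus n F)}
    (h : ∀ t : F, ∃ g ∈ S, Tr g = t) : CodewordMapIsIso S := by
  refine codewordMapIsIso_of_exists_trace_ne_zero fun a ha => ?_
  obtain ⟨b, hb⟩ := exists_trace_mul_ne_zero ha
  obtain ⟨g, hg, rfl⟩ := h b
  exact ⟨g, hg, by rwa [mul_comm]⟩

end Delsarte

/-! ### Matrix traces on the double cosets -/

section Traces

variable {F : Type*} [Field F]

theorem sigmaPlus_mul_parabolicElement_mem_DC {n : ℕ} (i : ℕ) (A : GL (Fin n) F)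
    (B : Matrix (Fin n) (Fin n) F) (hB : IsAlternating B) :
    sigmaPlus n (n - i) F * parabolicElement A B hB ∈ DC i n F :=
  DoubleCoset.mem_doubleCoset.2 ⟨1, one_mem _, _, ⟨A, B, hB, rfl⟩, by rw [one_mul]⟩

theorem Tr_sigmaPlus_mul_parabolicElement {n : ℕ} (r : ℕ) (A : GL (Fin n) F)
    (B : Matrix (Fin n) (Fin n) F) (hB : IsAlternating B) :
    Tr (sigmaPlus n r F * parabolicElement A B hB) =
      ∑ i : Fin n, if i.val < r then ((A : Matrix (Fin n) (Fin n) F) * B) i i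
        else (A : Matrix (Fin n) (Fin n) F) i i + ((A⁻¹ : GL (Fin n) F) : Matrix _ _ F) i i := by
  change Matrix.trace (sigmaMatrix n r F * parabolicMatrix A B) = _
  rw [parabolicMatrix_eq, sigmaMatrix, Matrix.fromBlocks_multiply]
  simp only [Matrix.trace, Matrix.diag_apply, Fintype.sum_sum_type, Matrix.fromBlocks_apply₁₁,
    Matrix.fromBlocks_apply₂₂, Matrix.add_apply, Matrix.diagonal_mul,
    Matrix.transpose_apply, Matrix.mul_zero, add_zero, ← Finset.sum_add_distrib]
  refine Finset.sum_congr rfl fun i _ => ?_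
  split_ifs <;> simp

/-- A transvection as an element of the general linear group. -/
def transvectionGL {n : ℕ} {i j : Fin n} (h : i ≠ j) (c : F) : GL (Fin n) F where
  val := Matrix.transvection i j c
  inv := Matrix.transvection i j (-c)
  val_inv := by rw [Matrix.transvection_mul_transvection_same _ _ h, add_neg_cancel,
    Matrix.transvection_zero]
  inv_val := by rw [Matrix.transvection_mul_transvection_same _ _ h, neg_add_cancel,
    Matrix.transvection_zero]

theorem isAlternating_zero {n : ℕ} : IsAlternating (0 : Matrix (Fin n) (Fin n) F) :=
  ⟨fun _ => rfl, fun _ _ => by simp⟩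

theorem isAlternating_single_sub_single {n : ℕ} {i j : Fin n} (h : i ≠ j) (b : F) :
    IsAlternating (Matrix.single i j b - Matrix.single j i b) := by
  refine ⟨fun k => ?_, fun k l => ?_⟩
  · simp only [Matrix.sub_apply, Matrix.single_apply]
    grind
  · simp only [Matrix.sub_apply, Matrix.single_apply]
    grind

/-- With `A = 1 + E₀₁` and `B = t(E₁₀ - E₀₁)`, the only nonzero diagonal entry of `A * B` is `t`, at
index 0, which is below `n - i`. The indices from `n - i` on contribute `1 + 1 = 0`. -/
theorem exists_mem_DC_Tr_eq [CharP F 2] {i n : ℕ} (hi : i < n) (hn : 2 ≤ n) (t : F) :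
    ∃ g ∈ DC i n F, Tr g = t := by
  let p : Fin n := ⟨0, by omega⟩
  let q : Fin n := ⟨1, by omega⟩
  have hpq : p ≠ q := by simp [p, q, Fin.ext_iff]
  refine ⟨_, sigmaPlus_mul_parabolicElement_mem_DC i (transvectionGL hpq 1) _
    (isAlternating_single_sub_single hpq.symm t), ?_⟩
  rw [Tr_sigmaPlus_mul_parabolicElement, Finset.sum_eq_single p]
  · rw [if_pos (by simp [p]; omega)]
    simp [transvectionGL, Matrix.transvection, Matrix.add_mul, Matrix.mul_sub, hpq.symm]
  · intro k _ hk
    split_ifs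
    · simp [transvectionGL, Matrix.transvection, Matrix.add_mul, Matrix.mul_sub,
        hpq.symm, hk.symm]
    · simp [transvectionGL, Matrix.transvection, hk.symm, CharTwo.add_self_eq_zero]
  · simp

theorem exists_mem_DC_two_two_Tr_eq [CharP F 2] [Finite F] (hF : 4 ≤ Nat.card F) (t : F) :
    ∃ g ∈ DC 2 2 F, Tr g = t := by
  classical
  have := Fintype.ofFinite F
  obtain ⟨d, hd⟩ : ∃ d, d ∉ ({0, 1} : Finset F) := by
    by_contra! h
    have h1 := Finset.card_le_card (fun x _ => h x : Finset.univ ⊆ ({0, 1} : Finset F))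
    have h2 := Finset.card_le_two (a := (0 : F)) (b := 1)
    rw [Finset.card_univ, ← Nat.card_eq_fintype_card] at h1
    omega
  obtain ⟨hd0, hd1⟩ : d ≠ 0 ∧ d ≠ 1 := by simpa using hd
  have hd2 : 1 + d ≠ 0 := fun h => hd1 (CharTwo.add_eq_zero.1 h).symm
  -- A 2 × 2 matrix of trace `s` and determinant `d` satisfies `tr A + tr A⁻¹ = s + s / d`; this `s`
  -- solves `s + s / d = t`.
  let s := t * d / (1 + d)
  let A : GL (Fin 2) F :=
    { val := !![s, d; 1, 0]
      inv := !![0, 1; 1 / d, s / d]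
      val_inv := by
        have := CharTwo.add_self_eq_zero s
        ext i j; fin_cases i <;> fin_cases j <;> simp [hd0, mul_div_cancel₀, this]
      inv_val := by
        have := CharTwo.add_self_eq_zero (s / d)
        ext i j; fin_cases i <;> fin_cases j <;> simp [hd0, div_eq_inv_mul] at this ⊢
        simp [this] }
  refine ⟨_, sigmaPlus_mul_parabolicElement_mem_DC 2 A 0 isAlternating_zero, ?_⟩
  rw [Tr_sigmaPlus_mul_parabolicElement]
  simp only [Nat.sub_self, Nat.not_lt_zero, if_false, Fin.sum_univ_two]
  change s + 0 + (0 + s / d) = t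
  simp only [s]
  field_simp
  ring

theorem exists_mem_DC_one_one_Tr_eq {x : F} (hx : x ≠ 0) :
    ∃ g ∈ DC 1 1 F, Tr g = x + x⁻¹ := by
  let A : GL (Fin 1) F :=
    { val := !![x]
      inv := !![x⁻¹]
      val_inv := by ext i j; fin_cases i; fin_cases j; simp [hx]
      inv_val := by ext i j; fin_cases i; fin_cases j; simp [hx] }
  refine ⟨_, sigmaPlus_mul_parabolicElement_mem_DC 1 A 0 isAlternating_zero, ?_⟩
  rw [Tr_sigmaPlus_mul_parabolicElement]
  simp only [Nat.sub_self, Nat.not_lt_zero, if_false, Fin.sum_univ_one]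
  rfl

end Traces

/-! ### The additive group generated by the elements x + x⁻¹ -/

section AddInv

variable {F : Type*} [Field F]

/-- The additive subgroup generated by the elements `x + x⁻¹` with `x ≠ 0`. -/
def addInvClosure (F : Type*) [Field F] : AddSubgroup F :=
  AddSubgroup.closure {t | ∃ x : F, x ≠ 0 ∧ t = x + x⁻¹}

theorem add_inv_mem_addInvClosure {x : F} (hx : x ≠ 0) : x + x⁻¹ ∈ addInvClosure F :=
  AddSubgroup.subset_closure ⟨x, hx, rfl⟩

/-- A product of two generators is the sum of the generators attached to `x * y` and `x * y⁻¹`. -/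
theorem mul_mem_addInvClosure {s t : F} (hs : s ∈ addInvClosure F) (ht : t ∈ addInvClosure F) :
    s * t ∈ addInvClosure F := by
  induction hs, ht using AddSubgroup.closure_induction₂ with
  | mem s t hs ht =>
    obtain ⟨x, hx, rfl⟩ := hs
    obtain ⟨y, hy, rfl⟩ := ht
    have h : (x + x⁻¹) * (y + y⁻¹) = (x * y + (x * y)⁻¹) + (x * y⁻¹ + (x * y⁻¹)⁻¹) := by
      rw [mul_inv, mul_inv, inv_inv]
      ring
    rw [h]
    exact add_mem (add_inv_mem_addInvClosure (mul_ne_zero hx hy))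
      (add_inv_mem_addInvClosure (mul_ne_zero hx (inv_ne_zero hy)))
  | zero_left t _ => rw [zero_mul]; exact zero_mem _
  | zero_right s _ => rw [mul_zero]; exact zero_mem _
  | add_left s s' t _ _ _ h h' => rw [add_mul]; exact add_mem h h'
  | add_right s t t' _ _ _ h h' => rw [mul_add]; exact add_mem h h'
  | neg_left s t _ _ h => rw [neg_mul]; exact neg_mem h
  | neg_right s t _ _ h => rw [mul_neg]; exact neg_mem h

theorem pow_mem_addInvClosure {s : F} (hs : s ∈ addInvClosure F) (k : ℕ) :
    s ^ (k + 1) ∈ addInvClosure F := by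
  induction k with
  | zero => simpa using hs
  | succ k ih => rw [pow_succ]; exact mul_mem_addInvClosure ih hs

theorem inv_mem_addInvClosure [Finite F] (hF : 3 ≤ Nat.card F) {s : F}
    (hs : s ∈ addInvClosure F) : s⁻¹ ∈ addInvClosure F := by
  have := Fintype.ofFinite F
  rw [Nat.card_eq_fintype_card] at hF
  rcases eq_or_ne s 0 with rfl | h0
  · simp
  -- The exponent is `q - 2`, written as a successor to fit `pow_mem_addInvClosure`.
  have h : s⁻¹ = s ^ (Fintype.card F - 3 + 1) := by
    refine inv_eq_of_mul_eq_one_right ?_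
    rw [← pow_succ', ← FiniteField.pow_card_sub_one_eq_one s h0]
    congr 1
    omega
  rw [h]
  exact pow_mem_addInvClosure hs _

theorem addInvClosure_eq_top [CharP F 2] [Finite F] (hF : 8 ≤ Nat.card F) :
    addInvClosure F = ⊤ := by
  classical
  have := Fintype.ofFinite F
  by_contra hne
  obtain ⟨x, hxK⟩ : ∃ x, x ∉ addInvClosure F := by
    by_contra! h
    exact hne (eq_top_iff.2 fun x _ => h x)
  have h2 : (2 : F) = 0 := CharTwo.two_eq_zero
  have hx : x ≠ 0 := fun h => hxK (h ▸ zero_mem _)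
  -- For `x` outside the subfield and `u` in it, adding the quadratic equations of `x` and `x + u`
  -- cancels `x²`. The linear relation left would put `x` in the subfield unless its coefficient `t
  -- + t'` vanishes, which forces `u = 0` or `u = t`.
  have hK : ∀ u ∈ addInvClosure F, u = 0 ∨ u = x + x⁻¹ := by
    intro u hu
    by_contra! hcon
    obtain ⟨hu0, hut⟩ := hcon
    have hxu : x + u ≠ 0 := fun h => hxK ((CharTwo.add_eq_zero.1 h) ▸ hu)
    have ht := add_inv_mem_addInvClosure hx
    have ht' := add_inv_mem_addInvClosure hxu
    have hx1 : x * (x + x⁻¹) = x * x + 1 := by rw [mul_add, mul_inv_cancel₀ hx]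
    have hx2 : (x + u) * (x + u + (x + u)⁻¹) = (x + u) * (x + u) + 1 := by
      rw [mul_add, mul_inv_cancel₀ hxu]
    generalize x + x⁻¹ = t at *
    generalize x + u + (x + u)⁻¹ = t' at *
    have key : (t + t') * x = (t' + u) * u := by
      linear_combination hx1 + hx2 + (x * x + x * u + 1 - t' * u) * h2
    rcases eq_or_ne (t + t') 0 with h0 | h0
    · rw [h0, zero_mul] at key
      have := (mul_eq_zero.1 key.symm).resolve_right hu0
      exact hut (((CharTwo.add_eq_zero.1 h0).trans (CharTwo.add_eq_zero.1 this)).symm)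
    · refine hxK ?_
      have : x = (t + t')⁻¹ * ((t' + u) * u) := by rw [← key, inv_mul_cancel_left₀ h0]
      rw [this]
      exact mul_mem_addInvClosure (inv_mem_addInvClosure (by omega) (add_mem ht ht'))
        (mul_mem_addInvClosure (add_mem ht' hu) hu)
  -- For `y ≠ 0`, `y + y⁻¹` is 0 or `x + x⁻¹`, so `y` is 1, `x` or `x⁻¹`. Hence `|F| ≤ 4`, a
  -- contradiction.
  have hall : (Finset.univ : Finset F) ⊆ {0, 1, x, x⁻¹} := by
    intro y _
    simp only [Finset.mem_insert, Finset.mem_singleton]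
    rcases eq_or_ne y 0 with hy | hy
    · exact Or.inl hy
    refine Or.inr ?_
    rcases hK _ (add_inv_mem_addInvClosure hy) with h | h
    · left
      have h1 := CharTwo.add_eq_zero.1 h
      have h3 : y * y = 1 := by
        nth_rewrite 2 [h1]
        exact mul_inv_cancel₀ hy
      have h4 : (y + 1) * (y + 1) = 0 := by linear_combination h3 + (y + 1) * h2
      exact CharTwo.add_eq_zero.1 (mul_self_eq_zero.1 h4)
    · right
      have h3 : (y - x) * (y - x⁻¹) = 0 := by
        linear_combination y * h - mul_inv_cancel₀ hy + mul_inv_cancel₀ hx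
      rcases mul_eq_zero.1 h3 with h4 | h4
      · exact Or.inl (sub_eq_zero.1 h4)
      · exact Or.inr (sub_eq_zero.1 h4)
  have h1 := Finset.card_le_card hall
  have h4 := Finset.card_le_four (a := (0 : F)) (b := 1) (c := x) (d := x⁻¹)
  rw [Finset.card_univ, ← Nat.card_eq_fintype_card] at h1
  omega

theorem exists_trace_mul_add_inv_ne_zero [Finite F] [Algebra (ZMod 2) F] (hF : 8 ≤ Nat.card F)
    {a : F} (ha : a ≠ 0) :
    ∃ x : F, x ≠ 0 ∧ Algebra.trace (ZMod 2) F (a * (x + x⁻¹)) ≠ 0 := by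
  have : CharP F 2 := charP_of_injective_algebraMap (algebraMap (ZMod 2) F).injective 2
  by_contra! h
  obtain ⟨b, hb⟩ := exists_trace_mul_ne_zero ha
  -- An additive map killing all generators `x + x⁻¹` kills the group they generate, here all of
  -- `F`.
  have hle : addInvClosure F ≤ AddMonoidHom.ker
      ((Algebra.trace (ZMod 2) F ∘ₗ LinearMap.mulLeft (ZMod 2) a).toAddMonoidHom) := by
    refine (AddSubgroup.closure_le _).2 ?_
    rintro _ ⟨x, hx, rfl⟩
    exact h x hx
  rw [addInvClosure_eq_top hF] at hle
  rw [mul_comm] at hb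
  exact hb (hle (AddSubgroup.mem_top b))

end AddInv

end OrthogonalCode

theorem theorem13 {F : Type*} [Field F] [Finite F] [Algebra (ZMod 2) F] :
    (∀ n : ℕ, 2 ≤ n → Even n → OrthogonalCode.CodewordMapIsIso (OrthogonalCode.DC 1 n F)) ∧
    (∀ n : ℕ, (4 ≤ n ∧ Even n) ∨ (n = 2 ∧ 4 ≤ Nat.card F) →
      OrthogonalCode.CodewordMapIsIso (OrthogonalCode.DC 2 n F)) ∧
    (∀ n : ℕ, (3 ≤ n ∧ Odd n) ∨ (n = 1 ∧ 8 ≤ Nat.card F) →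
      OrthogonalCode.CodewordMapIsIso (OrthogonalCode.DC 1 n F)) ∧
    (∀ n : ℕ, 3 ≤ n → Odd n → OrthogonalCode.CodewordMapIsIso (OrthogonalCode.DC 2 n F)) := by
  have : CharP F 2 := charP_of_injective_algebraMap (algebraMap (ZMod 2) F).injective 2
  have main : ∀ i n : ℕ, i < n → 2 ≤ n →
      OrthogonalCode.CodewordMapIsIso (OrthogonalCode.DC i n F) := fun i n hi hn =>
    OrthogonalCode.codewordMapIsIso_of_Tr_surjective (OrthogonalCode.exists_mem_DC_Tr_eq hi hn)
  refine ⟨fun n hn _ => main 1 n (by omega) hn, ?_, ?_, fun n hn _ => main 2 n hn (by omega)⟩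
  · rintro n (⟨hn, -⟩ | ⟨rfl, hF⟩)
    · exact main 2 n (by omega) (by omega)
    · exact OrthogonalCode.codewordMapIsIso_of_Tr_surjective
        (OrthogonalCode.exists_mem_DC_two_two_Tr_eq hF)
  · rintro n (⟨hn, -⟩ | ⟨rfl, hF⟩)
    · exact main 1 n (by omega) (by omega)
    · refine OrthogonalCode.codewordMapIsIso_of_exists_trace_ne_zero fun a ha => ?_
      obtain ⟨x, hx, h⟩ := OrthogonalCode.exists_trace_mul_add_inv_ne_zero hF ha
      obtain ⟨g, hg, hgx⟩ := OrthogonalCode.exists_mem_DC_one_one_Tr_eq hx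
      exact ⟨g, hg, by rwa [hgx]⟩
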